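/- Let $\mathbb{K}$ be one of the four normed division algebras $\mathbb{R},\mathbb{C},\mathbb{H},\mathbb{O}$, with conjugation $*$ and real part $\mathrm{Re}(a)=\tfrac12(a+a^*)$, and let $D=\dim_{\mathbb{R}}\mathbb{K}+3$, so that $D=4,5,7,11$ respectively. For a hermitian $2\times2$ matrix $A$ over $\mathbb{K}$ put $\tilde A=A-(\mathrm{tr}\,A)1$, and let $$\mathcal{V}=\Big\{\begin{pmatrix}a1&\tilde A\\A&-a1\end{pmatrix} : a\in\mathbb{R},\ A\in\mathfrak{h}_2(\mathbb{K})\Big\}\subseteq\mathbb{K}[4],\qquad \mathcal{S}=\mathbb{K}^4 .$$ The space $\mathcal{V}$ carries the Minkowski metric $h(\mathcal{A},\mathcal{B})=\tfrac14\mathrm{Re}\,\mathrm{tr}(\mathcal{A}\mathcal{B})$, for which $h(\mathcal{A},\mathcal{A})=-\det A+a^2$. Left multiplication of vectors on spinors, $\Gamma(\mathcal{A})\Psi=\mathcal{A}\Psi$, extends to an action of the Clifford algebra of $(\mathcal{V},h)$ on $\mathcal{S}$. Let $\langle\Psi,\Phi\rangle=\mathrm{Re}(\Psi^\dagger\Gamma^0\Phi)$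 with $\Gamma^0=\begin{pmatrix}0&-1\\1&0\end{pmatrix}$, and let $\Psi\cdot\Phi\in\mathcal{V}$ be the unique vector with $h(\Psi\cdot\Phi,\mathcal{A})=\langle\Psi,\mathcal{A}\Phi\rangle$ for all $\mathcal{A}\in\mathcal{V}$. The supertranslation algebra is the real Lie superalgebra $\mathcal{T}=\mathcal{V}\oplus\mathcal{S}$ with even part $\mathcal{V}$ and odd part $\mathcal{S}$, in which the bracket of two spinors is $[\Psi,\Phi]=\Psi\cdot\Phi$ and all brackets that involve a vector are zero. The $n$-cochains $C^n(\mathcal{T},\mathbb{R})$ are the super-skew-symmetric $n$-linear maps from $\mathcal{T}$ to the trivial representation $\mathbb{R}$, with the Chevalley–Eilenberg coboundary, given on homogeneous elements by $$d\omega(X_1,\dots,X_{n+1})=\sum_{i<j}(-1)^{i+j}(-1)^{|X_i||X_j|}\epsilon(i)\,\epsilon(j)\,\omega([X_i,X_j],X_1,\dots,\hat X_i,\dots,\hat X_j,\dots,X_{n+1}),\qquad \epsilon(j)=(-1)^{|X_j|(|X_1|+\cdots+|X_{j-1}|)} .$$ A cochain is a $(p,q)$-form if it vanishes on homogeneous arguments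 unless exactly $p$ of them are vectors and $q$ are spinors. **Theorem.** In each of the dimensions $D=4,5,7,11$ we have $\dim_{\mathbb{R}}\mathcal{V}=D$, and there is a unique $(2,2)$-form $\beta\in C^4(\mathcal{T},\mathbb{R})$ with $$\beta(\Psi,\Phi,\mathcal{A},\mathcal{B})=\langle\Psi,(\mathcal{A}\mathcal{B}-\mathcal{B}\mathcal{A})\Phi\rangle\qquad(\Psi,\Phi\in\mathcal{S},\ \mathcal{A},\mathcal{B}\in\mathcal{V}),$$ where the commutator is taken in the Clifford algebra of $(\mathcal{V},h)$. This $\beta$ is even and is a nontrivial cocycle: $d\beta=0$, and there is no $\theta\in C^3(\mathcal{T},\mathbb{R})$ with $\beta=d\theta$. -/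

import Mathlib

open scoped Quaternion

/-! ### Normed division algebras -/

namespace SuperMinkowski

/-- A (possibly nonassociative) unital real algebra with a conjugation `star`, a real part `re` with
`a + a* = 2 Re(a)`, and a norm `|a|² = Re(a* a)` that is positive definite and multiplicative. -/
class NormedDivisionAlgebra (K : Type) extends NonAssocRing K, StarRing K, Module ℝ K,
    IsScalarTower ℝ K K, SMulCommClass ℝ K K, StarModule ℝ K, Module.Finite ℝ K where
  re : K →ₗ[ℝ] ℝ
  add_star_self : ∀ a : K, a + star a = (2 * re a) • (1 : K)
  re_one : re 1 = 1
  re_mul_assoc : ∀ a b c : K, re ((a * b) * c) = re (a * (b * c))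
  star_mul_mul : ∀ a b : K, star a * (a * b) = re (star a * a) • b
  normSq_pos : ∀ a : K, a ≠ 0 → 0 < re (star a * a)
  normSq_mul : ∀ a b : K,
    re (star (a * b) * (a * b)) = re (star a * a) * re (star b * b)

/-- The octonions, by the Cayley–Dickson construction from Hamilton's quaternions. -/
def Octonion : Type := ℍ[ℝ] × ℍ[ℝ]

namespace Octonion

noncomputable instance : AddCommGroup Octonion := inferInstanceAs (AddCommGroup (ℍ[ℝ] × ℍ[ℝ]))

noncomputable instance : Module ℝ Octonion := inferInstanceAs (Module ℝ (ℍ[ℝ] × ℍ[ℝ]))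

instance : Module.Finite ℝ Octonion := inferInstanceAs (Module.Finite ℝ (ℍ[ℝ] × ℍ[ℝ]))

noncomputable instance : Mul Octonion :=
  ⟨fun x y => (x.1 * y.1 - star y.2 * x.2, y.2 * x.1 + x.2 * star y.1)⟩

noncomputable instance : One Octonion := ⟨((1 : ℍ[ℝ]), (0 : ℍ[ℝ]))⟩

noncomputable instance : Star Octonion := ⟨fun x => (star x.1, -x.2)⟩

@[ext] theorem ext' {x y : Octonion} (h₁ : x.1 = y.1) (h₂ : x.2 = y.2) : x = y := Prod.ext h₁ h₂

@[simp] theorem add_fst (x y : Octonion) : (x + y).1 = x.1 + y.1 := rfl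
@[simp] theorem add_snd (x y : Octonion) : (x + y).2 = x.2 + y.2 := rfl
@[simp] theorem zero_fst : (0 : Octonion).1 = 0 := rfl
@[simp] theorem zero_snd : (0 : Octonion).2 = 0 := rfl
@[simp] theorem one_fst : (1 : Octonion).1 = 1 := rfl
@[simp] theorem one_snd : (1 : Octonion).2 = 0 := rfl
@[simp] theorem smul_fst (r : ℝ) (x : Octonion) : (r • x).1 = r • x.1 := rfl
@[simp] theorem smul_snd (r : ℝ) (x : Octonion) : (r • x).2 = r • x.2 := rfl
@[simp] theorem star_fst (x : Octonion) : (star x).1 = star x.1 := rfl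
@[simp] theorem star_snd (x : Octonion) : (star x).2 = -x.2 := rfl
@[simp] theorem mul_fst (x y : Octonion) : (x * y).1 = x.1 * y.1 - star y.2 * x.2 := rfl
@[simp] theorem mul_snd (x y : Octonion) : (x * y).2 = y.2 * x.1 + x.2 * star y.1 := rfl

noncomputable instance : NonAssocRing Octonion where
  left_distrib x y z := by ext1 <;> simp [mul_add, add_mul] <;> abel
  right_distrib x y z := by ext1 <;> simp [mul_add, add_mul] <;> abel
  zero_mul x := by ext1 <;> simp
  mul_zero x := by ext1 <;> simp
  one_mul x := by ext1 <;> simp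
  mul_one x := by ext1 <;> simp

/-- The real part of an octonion. -/
noncomputable def reLin : Octonion →ₗ[ℝ] ℝ where
  toFun x := x.1.re
  map_add' _ _ := by simp
  map_smul' _ _ := by simp

@[simp] theorem reLin_apply (x : Octonion) : reLin x = x.1.re := rfl

end Octonion

noncomputable instance : NormedDivisionAlgebra Octonion where
  star_involutive x := by ext1 <;> simp
  star_mul x y := by
    ext1 <;> simp
  star_add x y := by ext1 <;> simp <;> abel
  smul_assoc r x y := by ext1 <;> simp [smul_sub, smul_add]
  smul_comm r x y := by ext1 <;> simp [smul_sub, smul_add]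
  star_smul r x := by ext1 <;> simp
  fg_top := (inferInstance : Module.Finite ℝ Octonion).fg_top
  re := Octonion.reLin
  add_star_self x := by ext <;> simp <;> ring
  re_one := by simp
  re_mul_assoc x y z := by simp; ring
  star_mul_mul x y := by ext <;> simp <;> ring
  normSq_pos x hx := by
    have h : Octonion.reLin (star x * x)
        = Quaternion.normSq x.1 + Quaternion.normSq x.2 := by
      simp [Quaternion.normSq_def']; ring
    rw [h]
    have h₁ := Quaternion.normSq_nonneg (a := x.1)
    have h₂ := Quaternion.normSq_nonneg (a := x.2)
    refine lt_of_le_of_ne (add_nonneg h₁ h₂) fun h₀ => hx ?_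
    have h₃ : Quaternion.normSq x.1 = 0 := by linarith
    have h₄ : Quaternion.normSq x.2 = 0 := by linarith
    exact Octonion.ext' (Quaternion.normSq_eq_zero.1 h₃) (Quaternion.normSq_eq_zero.1 h₄)
  normSq_mul x y := by simp; ring

noncomputable instance : NormedDivisionAlgebra ℝ where
  star_smul := star_smul
  re := LinearMap.id
  add_star_self a := by simp; ring
  re_one := rfl
  re_mul_assoc a b c := by simp [mul_assoc]
  star_mul_mul a b := by simp; ring
  normSq_pos a ha := by simpa using mul_self_pos.2 ha
  normSq_mul a b := by simp; ring

noncomputable instance : NormedDivisionAlgebra ℂ where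
  star_smul := star_smul
  re := Complex.reLm
  add_star_self a := by apply Complex.ext <;> simp; ring
  re_one := rfl
  re_mul_assoc a b c := by simp [mul_assoc]
  star_mul_mul a b := by apply Complex.ext <;> simp <;> ring
  normSq_pos a ha := by
    simpa [Complex.normSq_apply] using Complex.normSq_pos.2 ha
  normSq_mul a b := by simp; ring

/-- The real part of a quaternion. -/
def quaternionRe : ℍ[ℝ] →ₗ[ℝ] ℝ where
  toFun x := x.re
  map_add' x y := Quaternion.re_add x y
  map_smul' r x := Quaternion.re_smul x r

@[simp] theorem quaternionRe_apply (x : ℍ[ℝ]) : quaternionRe x = x.re := rfl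

noncomputable instance : NormedDivisionAlgebra ℍ[ℝ] where
  star_smul r x := by ext <;> simp
  re := quaternionRe
  add_star_self a := by ext <;> simp; ring
  re_one := by simp
  re_mul_assoc a b c := by simp [mul_assoc]
  star_mul_mul a b := by ext <;> simp <;> ring
  normSq_pos a ha := by
    have h : quaternionRe (star a * a) = Quaternion.normSq a := by
      simp [Quaternion.normSq_def']; ring
    rw [h]
    exact lt_of_le_of_ne Quaternion.normSq_nonneg
      fun h₀ => ha (Quaternion.normSq_eq_zero.1 h₀.symm)
  normSq_mul a b := by simp; ring

/-- `IsSpacetimeAlgebra D K` says that `K` is the one of the four normed division algebras `ℝ`, `ℂ`,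
`ℍ`, `𝕆` that belongs to the spacetime dimension `D = dim K + 3`. -/
inductive IsSpacetimeAlgebra : (D : ℕ) → (K : Type) → [NormedDivisionAlgebra K] → Prop
  | real : IsSpacetimeAlgebra 4 ℝ
  | complex : IsSpacetimeAlgebra 5 ℂ
  | quaternion : IsSpacetimeAlgebra 7 ℍ[ℝ]
  | octonion : IsSpacetimeAlgebra 11 Octonion

namespace NormedDivisionAlgebra

variable {K : Type} [NormedDivisionAlgebra K]

theorem star_eq (a : K) : star a = (2 * re a) • (1 : K) - a := by
  rw [← add_star_self, add_sub_cancel_left]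

theorem re_star (a : K) : re (star a) = re a := by
  rw [star_eq]; simp [re_one]; ring

theorem re_mul_comm (a b : K) : re (a * b) = re (b * a) := by
  have h : re (a * b) = re (star b * star a) := by rw [← star_mul, re_star]
  rw [h, star_eq, star_eq]
  simp [sub_mul, mul_sub, re_one]; ring

theorem eq_re_smul_one {a : K} (h : star a = a) : a = re a • (1 : K) := by
  have := add_star_self a
  rw [h, ← two_smul ℝ, mul_smul] at this
  exact smul_right_injective K (two_ne_zero (α := ℝ)) this

end NormedDivisionAlgebra

/-! ### Vectors, spinors and the Clifford action in `dim K + 3` dimensions -/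

open NormedDivisionAlgebra

section Vectors

variable (K : Type) [NormedDivisionAlgebra K]

/-- The space `𝔥₂(K)` of hermitian `2 × 2` matrices with entries in `K`. -/
def hermitian2 : Submodule ℝ (Matrix (Fin 2) (Fin 2) K) where
  carrier := {A | A.conjTranspose = A}
  add_mem' {A B} hA hB := by
    simp only [Set.mem_ofPred_eq] at *
    rw [Matrix.conjTranspose_add, hA, hB]
  zero_mem' := by simp
  smul_mem' r A hA := by
    simp only [Set.mem_ofPred_eq] at *
    rw [Matrix.conjTranspose_smul, hA]; simp

variable {K}

/-- Trace reversal `A ↦ A - tr(A) 1`. -/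
def traceReversal (A : Matrix (Fin 2) (Fin 2) K) : Matrix (Fin 2) (Fin 2) K :=
  A - Matrix.diagonal fun _ => A.trace

/-- The `4 × 4` matrix with blocks `a 1`, `Ã`, `A`, `-a 1`. -/
def blockMatrix (a : ℝ) (A : Matrix (Fin 2) (Fin 2) K) :
    Matrix (Fin 2 ⊕ Fin 2) (Fin 2 ⊕ Fin 2) K :=
  Matrix.fromBlocks (a • 1) (traceReversal A) A (-(a • 1))

variable (K)

/-- The space `𝒱` of vectors of Minkowski spacetime. -/
def Vectors : Submodule ℝ (Matrix (Fin 2 ⊕ Fin 2) (Fin 2 ⊕ Fin 2) K) where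
  carrier := {M | ∃ a : ℝ, ∃ A ∈ hermitian2 K, M = blockMatrix a A}
  add_mem' := by
    rintro _ _ ⟨a, A, hA, rfl⟩ ⟨b, B, hB, rfl⟩
    refine ⟨a + b, A + B, add_mem hA hB, ?_⟩
    rw [blockMatrix, blockMatrix, blockMatrix, Matrix.fromBlocks_add]
    congr 1
    · rw [add_smul]
    · ext i j; by_cases h : i = j <;> simp [traceReversal, Matrix.diagonal, h]; abel
    · rw [add_smul, neg_add]
  zero_mem' := ⟨0, 0, zero_mem _, by
    ext i j; rcases i with i | i <;> rcases j with j | j <;>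
      simp [blockMatrix, traceReversal]⟩
  smul_mem' := by
    rintro r _ ⟨a, A, hA, rfl⟩
    refine ⟨r * a, r • A, Submodule.smul_mem _ r hA, ?_⟩
    rw [blockMatrix, blockMatrix, Matrix.fromBlocks_smul]
    congr 1
    · rw [mul_smul]
    · ext i j; by_cases h : i = j <;>
        simp [traceReversal, Matrix.diagonal, h, smul_sub]
    · rw [mul_smul, smul_neg]

/-- The space `𝒮 = S₊ ⊕ S₋ = K⁴` of spinors. -/
abbrev Spinors : Type := Fin 2 ⊕ Fin 2 → K

variable {K}

/-- The Minkowski metric `h(𝒜, ℬ) = ¼ Re tr(𝒜ℬ)` on vectors; see `metric_self`. -/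
noncomputable def metric : LinearMap.BilinForm ℝ (Vectors K) :=
  LinearMap.mk₂ ℝ
    (fun M N => (1 / 4 : ℝ) *
      re ((M : Matrix (Fin 2 ⊕ Fin 2) (Fin 2 ⊕ Fin 2) K) *
        (N : Matrix (Fin 2 ⊕ Fin 2) (Fin 2 ⊕ Fin 2) K)).trace)
    (fun M M' N => by simp [Matrix.add_mul, mul_add])
    (fun r M N => by simp; ring)
    (fun M N N' => by simp [mul_add])
    (fun r M N => by simp; ring)

/-- Every hermitian `2 × 2` matrix has the form `(t + x, y; y*, t - x)`. -/
theorem exists_of_mem_hermitian2 {A : Matrix (Fin 2) (Fin 2) K} (hA : A ∈ hermitian2 K) :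
    ∃ (t x : ℝ) (y : K), A = !![(t + x) • 1, y; star y, (t - x) • 1] := by
  have h : ∀ i j, star (A j i) = A i j := fun i j => by
    conv_rhs => rw [← show A.conjTranspose = A from hA]
    rfl
  refine ⟨(re (A 0 0) + re (A 1 1)) / 2, (re (A 0 0) - re (A 1 1)) / 2, A 0 1, ?_⟩
  ext i j
  fin_cases i <;> fin_cases j
  · simpa [show (re (A 0 0) + re (A 1 1)) / 2 + (re (A 0 0) - re (A 1 1)) / 2 = re (A 0 0) by ring]
      using eq_re_smul_one (h 0 0)
  · simp
  · simpa using (h 1 0).symm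
  · simpa [show (re (A 0 0) + re (A 1 1)) / 2 - (re (A 0 0) - re (A 1 1)) / 2 = re (A 1 1) by ring]
      using eq_re_smul_one (h 1 1)

theorem mem_hermitian2 (t x : ℝ) (y : K) :
    !![(t + x) • 1, y; star y, (t - x) • 1] ∈ hermitian2 K := by
  show Matrix.conjTranspose _ = _
  ext i j
  fin_cases i <;> fin_cases j <;> simp

theorem traceReversal_eq (t x : ℝ) (y : K) :
    traceReversal !![(t + x) • 1, y; star y, (t - x) • 1] =
      !![(-t + x) • 1, y; star y, (-t - x) • 1] := by
  ext i j
  fin_cases i <;> fin_cases j <;>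
    simp [traceReversal, Matrix.trace_fin_two] <;> module

/-- The vector with the components `a`, `t`, `x`, `y`. -/
def vec (a t x : ℝ) (y : K) : Vectors K :=
  ⟨blockMatrix a !![(t + x) • 1, y; star y, (t - x) • 1], a, _, mem_hermitian2 t x y, rfl⟩

theorem exists_vec (M : Vectors K) : ∃ (a t x : ℝ) (y : K), M = vec a t x y := by
  obtain ⟨_, a, A, hA, rfl⟩ := M
  obtain ⟨t, x, y, rfl⟩ := exists_of_mem_hermitian2 hA
  exact ⟨a, t, x, y, rfl⟩

theorem metric_vec (a t x a' t' x' : ℝ) (y y' : K) :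
    metric (vec a t x y) (vec a' t' x' y') = a * a' - t * t' + x * x' + re (star y * y') := by
  have h₁ : re (y * star y') = re (star y * y') := by
    rw [star_eq, star_eq]
    simp [sub_mul, mul_sub]; ring
  simp only [metric, LinearMap.mk₂_apply, vec, blockMatrix, traceReversal_eq,
    Matrix.fromBlocks_multiply]
  simp [Matrix.trace, Fintype.sum_sum_type, re_one, h₁]
  ring

/-- The metric extends the Minkowski metric `-det` of `𝔥₂(K)` by one spatial dimension. -/
theorem metric_self (M : Vectors K) (a : ℝ) (A : Matrix (Fin 2) (Fin 2) K)
    (hA : A ∈ hermitian2 K) (hM : (M : Matrix _ _ K) = blockMatrix a A) :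
    metric M M = -re (A 0 0 * A 1 1 - A 0 1 * A 1 0) + a ^ 2 := by
  obtain ⟨t, x, y, rfl⟩ := exists_of_mem_hermitian2 hA
  obtain rfl : M = vec a t x y := Subtype.ext hM
  rw [metric_vec]
  simp [re_one, re_mul_comm y (star y)]
  ring

theorem metric_separatingLeft (M : Vectors K) (hM : ∀ N, metric M N = 0) : M = 0 := by
  obtain ⟨a, t, x, y, rfl⟩ := exists_vec M
  have h := hM (vec a (-t) x y)
  rw [metric_vec] at h
  have hy₀ : 0 ≤ re (star y * y) := by
    by_cases hy : y = 0
    · simp [hy]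
    · exact (normSq_pos y hy).le
  have hy : y = 0 := by
    by_contra hy
    nlinarith [normSq_pos y hy, mul_self_nonneg a, mul_self_nonneg t, mul_self_nonneg x]
  have ha : a = 0 := by
    nlinarith [mul_self_nonneg a, mul_self_nonneg t, mul_self_nonneg x]
  have ht : t = 0 := by
    nlinarith [mul_self_nonneg a, mul_self_nonneg t, mul_self_nonneg x]
  have hx : x = 0 := by
    nlinarith [mul_self_nonneg a, mul_self_nonneg t, mul_self_nonneg x]
  subst hy ha ht hx
  apply Subtype.ext
  ext i j
  rcases i with i | i <;> rcases j with j | j <;> fin_cases i <;> fin_cases j <;>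
    simp [vec, blockMatrix, traceReversal]

theorem metric_comm (M N : Vectors K) : metric M N = metric N M := by
  obtain ⟨a, t, x, y, rfl⟩ := exists_vec M
  obtain ⟨a', t', x', y', rfl⟩ := exists_vec N
  rw [metric_vec, metric_vec, ← re_star (star y * y'), star_mul, star_star]
  ring

theorem metric_nondegenerate : (metric (K := K)).Nondegenerate :=
  ⟨metric_separatingLeft, fun N hN => metric_separatingLeft N fun M => by
    rw [metric_comm]; exact hN M⟩

/-- The map `Γ`: vectors act on spinors by left multiplication. -/
def gamma : Vectors K →ₗ[ℝ] Module.End ℝ (Spinors K) :=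
  LinearMap.mk₂ ℝ (fun M Ψ => (M : Matrix (Fin 2 ⊕ Fin 2) (Fin 2 ⊕ Fin 2) K).mulVec Ψ)
    (fun M M' Ψ => by simp [Matrix.add_mulVec])
    (fun r M Ψ => by simp [Matrix.smul_mulVec])
    (fun M Ψ Φ => by simp [Matrix.mulVec_add])
    (fun r M Ψ => by simp [Matrix.mulVec_smul])

theorem gamma_apply (M : Vectors K) (Ψ : Spinors K) :
    gamma M Ψ = (M : Matrix (Fin 2 ⊕ Fin 2) (Fin 2 ⊕ Fin 2) K).mulVec Ψ := rfl

variable (K) in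
/-- The quadratic form of the Minkowski metric. -/
noncomputable def metricForm : QuadraticForm ℝ (Vectors K) :=
  LinearMap.BilinMap.toQuadraticMap metric

theorem mul_star_mul (a b : K) : a * (star a * b) = re (star a * a) • b := by
  have h := star_mul_mul (star a) b
  rwa [star_star, re_mul_comm a] at h

theorem gamma_gamma (M : Vectors K) (Ψ : Spinors K) :
    gamma M (gamma M Ψ) = metric M M • Ψ := by
  obtain ⟨a, t, x, y, rfl⟩ := exists_vec M
  rw [metric_vec, gamma_apply, gamma_apply]
  ext i
  simp only [vec, blockMatrix, traceReversal_eq]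
  rcases i with i | i <;> fin_cases i <;>
    simp [Matrix.mulVec, dotProduct, Fintype.sum_sum_type, mul_add, mul_smul_comm, star_mul_mul,
      mul_star_mul]
      <;> module

theorem gamma_mul_self (M : Vectors K) :
    gamma M * gamma M = algebraMap ℝ (Module.End ℝ (Spinors K)) (metricForm K M) := by
  exact LinearMap.ext fun Ψ => gamma_gamma M Ψ

/-- The action of the Clifford algebra of `𝒱` on spinors. -/
noncomputable def cliffordAction :
    CliffordAlgebra (metricForm K) →ₐ[ℝ] Module.End ℝ (Spinors K) :=
  CliffordAlgebra.lift (metricForm K) ⟨gamma (K := K), fun M => gamma_mul_self M⟩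

/-- The commutator `𝒜ℬ - ℬ𝒜` of two vectors in the Clifford algebra of `𝒱`. -/
noncomputable def cliffordCommutator (A B : Vectors K) : CliffordAlgebra (metricForm K) :=
  CliffordAlgebra.ι (metricForm K) A * CliffordAlgebra.ι (metricForm K) B -
    CliffordAlgebra.ι (metricForm K) B * CliffordAlgebra.ι (metricForm K) A

/-- The matrix `Γ⁰` with blocks `0`, `-1`, `1`, `0`. -/
def gammaZero : Matrix (Fin 2 ⊕ Fin 2) (Fin 2 ⊕ Fin 2) K := Matrix.fromBlocks 0 (-1) 1 0

/-- The pairing `⟨Ψ, Φ⟩ = Re(Ψ† Γ⁰ Φ)` of spinors. -/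
def spinorForm : LinearMap.BilinForm ℝ (Spinors K) :=
  LinearMap.mk₂ ℝ (fun Ψ Φ => re (dotProduct (star Ψ) (gammaZero.mulVec Φ)))
    (fun Ψ Ψ' Φ => by simp)
    (fun r Ψ Φ => by simp [star_smul])
    (fun Ψ Φ Φ' => by simp [Matrix.mulVec_add])
    (fun r Ψ Φ => by simp [Matrix.mulVec_smul])

/-- The linear form `𝒜 ↦ ⟨Ψ, Γ(𝒜) Φ⟩` on vectors, bilinear in `Ψ` and `Φ`. -/
def spinorCurrent : Spinors K →ₗ[ℝ] Spinors K →ₗ[ℝ] Module.Dual ℝ (Vectors K) :=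
  LinearMap.mk₂ ℝ (fun Ψ Φ => (spinorForm Ψ).comp (gamma.flip Φ))
    (fun Ψ Ψ' Φ => by ext; simp)
    (fun r Ψ Φ => by ext; simp)
    (fun Ψ Φ Φ' => by ext; simp)
    (fun r Ψ Φ => by ext; simp)

/-- The operation `Ψ · Φ`: the vector with `h(Ψ · Φ, 𝒜) = ⟨Ψ, Γ(𝒜) Φ⟩` for all vectors `𝒜`. -/
noncomputable def spinorDot : Spinors K →ₗ[ℝ] Spinors K →ₗ[ℝ] Vectors K :=
  spinorCurrent.compr₂ (metric.toDual metric_nondegenerate).symm.toLinearMap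

theorem metric_spinorDot (Ψ Φ : Spinors K) (M : Vectors K) :
    metric (spinorDot Ψ Φ) M = spinorForm Ψ (gamma M Φ) := by
  have h := LinearMap.BilinForm.apply_toDual_symm_apply (B := metric (K := K))
    (hB := metric_nondegenerate) (spinorCurrent Ψ Φ) M
  exact h

theorem spinorForm_gamma_comm (Ψ Φ : Spinors K) (M : Vectors K) :
    spinorForm Ψ (gamma M Φ) = spinorForm Φ (gamma M Ψ) := by
  obtain ⟨a, t, x, y, rfl⟩ := exists_vec M
  have h₁ : ∀ p q : K, re (star p * q) = re (star q * p) := fun p q => by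
    rw [← re_star, star_mul, star_star]
  have h₂ : ∀ p q : K, re (star p * (star y * q)) = re (star q * (y * p)) := fun p q => by
    rw [← re_star, star_mul, star_mul, star_star, star_star, re_mul_assoc]
  simp only [spinorForm, LinearMap.mk₂_apply, gamma_apply, vec, blockMatrix, traceReversal_eq,
    gammaZero]
  simp [Matrix.mulVec, dotProduct, Fintype.sum_sum_type, mul_add, mul_smul_comm, h₂]
  linear_combination -(t + x) * h₁ (Ψ (.inl 0)) (Φ (.inl 0)) - (t - x) * h₁ (Ψ (.inl 1)) (Φ (.inl 1))
    + a * h₁ (Ψ (.inl 0)) (Φ (.inr 0)) + a * h₁ (Ψ (.inl 1)) (Φ (.inr 1))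
    + a * h₁ (Ψ (.inr 0)) (Φ (.inl 0)) + a * h₁ (Ψ (.inr 1)) (Φ (.inl 1))
    + (-t + x) * h₁ (Ψ (.inr 0)) (Φ (.inr 0)) + (-t - x) * h₁ (Ψ (.inr 1)) (Φ (.inr 1))

theorem spinorDot_comm (Ψ Φ : Spinors K) : spinorDot Ψ Φ = spinorDot Φ Ψ := by
  rw [← sub_eq_zero]
  refine metric_separatingLeft _ fun M => ?_
  rw [map_sub, LinearMap.sub_apply, metric_spinorDot, metric_spinorDot, spinorForm_gamma_comm,
    sub_self]

end Vectors

/-! ### Lie superalgebras and their cohomology with trivial coefficients -/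

/-- The sign `(-1)^(ij)` of parities `i` and `j`. -/
def koszul (i j : ZMod 2) : ℝ := (-1) ^ (i.val * j.val)

/-- A real Lie superalgebra: the even part is `part 0`, the odd part is `part 1`. -/
class LieSuperalgebra (L : Type*) [AddCommGroup L] [Module ℝ L] where
  part : ZMod 2 → Submodule ℝ L
  isCompl : IsCompl (part 0) (part 1)
  bracket : L →ₗ[ℝ] L →ₗ[ℝ] L
  bracket_mem : ∀ {i j : ZMod 2} {x y : L}, x ∈ part i → y ∈ part j → bracket x y ∈ part (i + j)
  bracket_skew : ∀ {i j : ZMod 2} {x y : L}, x ∈ part i → y ∈ part j →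
    bracket x y = -(koszul i j • bracket y x)
  jacobi : ∀ {i j k : ZMod 2} {x y z : L}, x ∈ part i → y ∈ part j → z ∈ part k →
    bracket x (bracket y z) = bracket (bracket x y) z + koszul i j • bracket y (bracket x z)

section Cohomology

open LieSuperalgebra

variable (L : Type*) [AddCommGroup L] [Module ℝ L] [LieSuperalgebra L]

/-- The `n`-cochains `Cⁿ(L, ℝ)`: super-skew-symmetric `n`-linear maps. Exchanging two adjacent
homogeneous arguments of parities `i` and `j` multiplies the value by `-(-1)^(ij)`. -/
def Cochain (n : ℕ) : Submodule ℝ (MultilinearMap ℝ (fun _ : Fin n => L) ℝ) where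
  carrier := {ω | ∀ (p : Fin n → ZMod 2) (X : Fin n → L), (∀ k, X k ∈ part (p k)) →
    ∀ i j : Fin n, (i : ℕ) + 1 = j →
      ω (X ∘ Equiv.swap i j) = -(koszul (p i) (p j) * ω X)}
  add_mem' {ω η} hω hη p X hX i j hij := by
    rw [add_apply, add_apply, hω p X hX i j hij, hη p X hX i j hij]
    ring
  zero_mem' p X hX i j hij := by simp
  smul_mem' r ω hω p X hX i j hij := by
    rw [smul_apply, smul_apply, hω p X hX i j hij, smul_eq_mul,
      smul_eq_mul]
    ring

variable {L}

/-- The sign of moving the `j`-th of homogeneous elements with parities `p` past all elements before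
it. -/
def moveSign {n : ℕ} (p : Fin n → ZMod 2) (j : Fin n) : ℝ :=
  ∏ k ∈ Finset.univ.filter (· < j), koszul (p j) (p k)

/-- The value of the coboundary `dω` at homogeneous elements `X` with parities `p`:
`∑_{i < j} (-1)^(i+j) (-1)^(|Xᵢ||Xⱼ|) ε(i) ε(j) ω([Xᵢ, Xⱼ], X₀, …, X̂ᵢ, …, X̂ⱼ, …)`,
where `ε(j)` is `moveSign p j`. The terms that involve the action of `L` on the coefficients vanish,
since the coefficients are the trivial representation. -/
def coboundary {n : ℕ} (ω : MultilinearMap ℝ (fun _ : Fin (n + 1) => L) ℝ)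
    (p : Fin (n + 2) → ZMod 2) (X : Fin (n + 2) → L) : ℝ :=
  ∑ j : Fin (n + 2), ∑ i : Fin (n + 1), if i.castSucc < j then
    (-1) ^ ((i : ℕ) + (j : ℕ)) * koszul (p i.castSucc) (p j) *
      moveSign p i.castSucc * moveSign p j *
      ω (Fin.cons (bracket (X i.castSucc) (X j)) (i.removeNth (j.removeNth X)))
  else 0

/-- `ω` is closed, or a cocycle: `dω = 0`. -/
def IsClosedCochain {n : ℕ} (ω : Cochain L (n + 1)) : Prop :=
  ∀ (p : Fin (n + 2) → ZMod 2) (X : Fin (n + 2) → L), (∀ k, X k ∈ part (p k)) →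
    coboundary ω.1 p X = 0

/-- `η` is exact, or a coboundary: `η = dω` for some cochain `ω`. -/
def IsExactCochain {n : ℕ} (η : Cochain L (n + 2)) : Prop :=
  ∃ ω : Cochain L (n + 1), ∀ (p : Fin (n + 2) → ZMod 2) (X : Fin (n + 2) → L),
    (∀ k, X k ∈ part (p k)) → η.1 X = coboundary ω.1 p X

/-- `ω` is even, that is, parity-preserving: it vanishes at homogeneous elements of odd total
parity, because `ℝ` is purely even. -/
def IsEvenCochain {n : ℕ} (ω : Cochain L n) : Prop :=
  ∀ (p : Fin n → ZMod 2) (X : Fin n → L), (∀ k, X k ∈ part (p k)) → ∑ k, p k = 1 → ω.1 X = 0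

/-- `ω` is a `(p, q)`-form: it vanishes at homogeneous elements unless `p` of them are even and `q`
of them are odd. -/
def IsForm (p q : ℕ) (ω : Cochain L (p + q)) : Prop :=
  ∀ (s : Fin (p + q) → ZMod 2) (X : Fin (p + q) → L), (∀ k, X k ∈ part (s k)) →
    (Finset.univ.filter fun k => s k = 1).card ≠ q → ω.1 X = 0

end Cohomology

/-! ### The supertranslation algebra -/

section Supertranslation

variable (K : Type) [NormedDivisionAlgebra K]

/-- The supertranslation algebra `𝒯 = 𝒱 ⊕ 𝒮`. -/
abbrev Supertranslation : Type := Vectors K × Spinors K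

variable {K}

/-- The bracket of the supertranslation algebra: two spinors have the bracket `Ψ · Φ`, all other
brackets are zero. -/
noncomputable def superBracket :
    Supertranslation K →ₗ[ℝ] Supertranslation K →ₗ[ℝ] Supertranslation K :=
  (spinorDot.compl₁₂ (LinearMap.snd ℝ (Vectors K) (Spinors K))
    (LinearMap.snd ℝ (Vectors K) (Spinors K))).compr₂ (LinearMap.inl ℝ (Vectors K) (Spinors K))

theorem superBracket_apply (x y : Supertranslation K) :
    superBracket x y = (spinorDot x.2 y.2, 0) := rfl

/-- The grading: vectors are even, spinors are odd. -/
def superPart (i : ZMod 2) : Submodule ℝ (Supertranslation K) :=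
  if i = 0 then Submodule.prod ⊤ ⊥ else Submodule.prod ⊥ ⊤

theorem mem_superPart_zero {x : Supertranslation K} : x ∈ superPart (K := K) 0 ↔ x.2 = 0 := by
  simp [superPart, Submodule.mem_prod]

theorem mem_superPart_one {x : Supertranslation K} : x ∈ superPart (K := K) 1 ↔ x.1 = 0 := by
  simp [superPart, Submodule.mem_prod]

theorem parity_cases : ∀ i : ZMod 2, i = 0 ∨ i = 1 := by decide

noncomputable instance : LieSuperalgebra (Supertranslation K) where
  part := superPart
  isCompl := by
    rw [isCompl_iff, Submodule.disjoint_def, codisjoint_iff, Submodule.eq_top_iff']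
    refine ⟨fun x h₀ h₁ => Prod.ext (mem_superPart_one.1 h₁) (mem_superPart_zero.1 h₀),
      fun x => ?_⟩
    exact Submodule.mem_sup.2 ⟨(x.1, 0), mem_superPart_zero.2 rfl, (0, x.2),
      mem_superPart_one.2 rfl, by simp⟩
  bracket := superBracket
  bracket_mem {i j x y} hx hy := by
    rw [superBracket_apply]
    obtain rfl | rfl : i = 0 ∨ i = 1 := parity_cases i
    · rw [mem_superPart_zero.1 hx]; simp [← Prod.zero_eq_mk]
    obtain rfl | rfl : j = 0 ∨ j = 1 := parity_cases j
    · rw [mem_superPart_zero.1 hy]; simp [← Prod.zero_eq_mk]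
    exact mem_superPart_zero.2 rfl
  bracket_skew {i j x y} hx hy := by
    rw [superBracket_apply, superBracket_apply]
    obtain rfl | rfl : i = 0 ∨ i = 1 := parity_cases i
    · rw [mem_superPart_zero.1 hx]; simp
    obtain rfl | rfl : j = 0 ∨ j = 1 := parity_cases j
    · rw [mem_superPart_zero.1 hy]; simp
    rw [spinorDot_comm x.2 y.2, show koszul 1 1 = -1 by simp [koszul, ZMod.val_one]]
    simp
  jacobi {i j k x y z} hx hy hz := by
    simp [superBracket_apply]

end Supertranslation

end SuperMinkowski

open SuperMinkowski

/-! Write `Ψ = (ψ, φ)` with `ψ, φ ∈ K²`. Then `(Ψ · Ψ) Ψ = (χ(ψ, φ), -χ(φ, ψ))` with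
`χ(ψ, φ) = 2 Re(ψ†φ) ψ - 2 (ψψ†)φ`. For associative `K` this is `-2 ψ Im(ψ†φ)`, an infinitesimal
phase rotation of `ψ`, which does not change `ψψ†`. In general the multiplication is alternative,
and this suffices for `χψ† + ψχ† = 0`. Hence `Re(χ†Aψ) = 0` for every hermitian `A`, and it follows
that `⟨(Ψ · Ψ) Ψ, 𝒜 Ψ⟩ = 0` for every vector `𝒜`. This says `β(Ψ, Ψ, 𝒜, Ψ · Ψ) = 0`, and the
polarization of this identity in `Ψ` is `dβ = 0`.

A coboundary vanishes at elements whose mutual brackets are all zero. There are spinors with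
`Ψ · Φ = 0` and `⟨Ψ, (𝒜ℬ - ℬ𝒜) Φ⟩ ≠ 0` for suitable vectors, so `β` is not a coboundary. -/

namespace SuperMinkowski

open Matrix NormedDivisionAlgebra LieSuperalgebra

section DivisionAlgebra

variable {K : Type} [NormedDivisionAlgebra K]

theorem re_star_mul_comm (a b : K) : re (star a * b) = re (star b * a) := by
  rw [← re_star, star_mul, star_star]

theorem mul_star_mul_add_mul_star_mul (a b c : K) :
    a * (star b * c) + b * (star a * c) = (2 * re (star a * b)) • c := by
  have h := mul_star_mul (a + b) c
  simp only [star_add, add_mul, mul_add, map_add, add_smul, mul_star_mul,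
    re_star_mul_comm b a] at h
  rw [two_mul, add_smul, ← sub_eq_zero]
  rw [← sub_eq_zero] at h
  rw [← h]
  abel

theorem mul_mul_star_add_mul_mul_star (a b c : K) :
    c * a * star b + c * b * star a = (2 * re (star a * b)) • c := by
  have h := congrArg star (mul_star_mul_add_mul_star_mul b a (star c))
  rw [re_star_mul_comm b a] at h
  simpa using h

theorem mul_star_mul_self (a b : K) : a * star b * b = re (star b * b) • a := by
  simpa using congrArg star (star_mul_mul b (star a))

theorem mul_star_self (a : K) : a * star a = re (star a * a) • (1 : K) := by
  simpa using mul_star_mul a 1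

end DivisionAlgebra

section Matrices

variable {K : Type} [NormedDivisionAlgebra K] {m n : Type*}

/-- The hermitian matrix `ψ φ† + φ ψ†`, the polarization of the outer square `ψ ↦ ψ ψ†`; on the
diagonal it is `2 ψ ψ†`. -/
def hermitianOuter (ψ φ : n → K) : Matrix n n K :=
  vecMulVec ψ (star φ) + vecMulVec φ (star ψ)

theorem hermitianOuter_apply (ψ φ : n → K) (i j : n) :
    hermitianOuter ψ φ i j = ψ i * star (φ j) + φ i * star (ψ j) := rfl

theorem conjTranspose_hermitianOuter (ψ φ : n → K) :
    (hermitianOuter ψ φ)ᴴ = hermitianOuter ψ φ := by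
  simp [hermitianOuter, conjTranspose_vecMulVec, add_comm]

variable [Fintype m] [Fintype n]

theorem re_star_dotProduct_comm (ψ φ : n → K) : re (star ψ ⬝ᵥ φ) = re (star φ ⬝ᵥ ψ) := by
  simp only [dotProduct, Pi.star_apply, map_sum, re_star_mul_comm]

theorem re_trace_mul_comm (A : Matrix m n K) (B : Matrix n m K) :
    re (A * B).trace = re (B * A).trace := by
  simp only [trace, diag, mul_apply, map_sum, re_mul_comm (A _ _)]
  exact Finset.sum_comm

theorem re_star_dotProduct_mulVec (A : Matrix m n K) (ψ : m → K) (φ : n → K) :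
    re (star ψ ⬝ᵥ A *ᵥ φ) = re (A * vecMulVec φ (star ψ)).trace := by
  simp only [dotProduct, mulVec, trace, diag, mul_apply, vecMulVec_apply, Pi.star_apply, map_sum,
    Finset.mul_sum, re_mul_comm (star _), re_mul_assoc]

theorem re_star_dotProduct_conjTranspose_mulVec (A : Matrix m n K) (ψ : m → K) (φ : n → K) :
    re (star φ ⬝ᵥ Aᴴ *ᵥ ψ) = re (star ψ ⬝ᵥ A *ᵥ φ) := by
  simp only [dotProduct, mulVec, conjTranspose_apply, Pi.star_apply, map_sum, Finset.mul_sum]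
  rw [Finset.sum_comm]
  refine Finset.sum_congr rfl fun i _ => Finset.sum_congr rfl fun j _ => ?_
  rw [← re_star, star_mul, star_mul, star_star, star_star, re_mul_assoc]

theorem re_trace_mul_hermitianOuter {A : Matrix n n K} (hA : Aᴴ = A) (ψ φ : n → K) :
    re (A * hermitianOuter ψ φ).trace = 2 * re (star ψ ⬝ᵥ A *ᵥ φ) := by
  have h := re_star_dotProduct_conjTranspose_mulVec A ψ φ
  rw [hA] at h
  rw [hermitianOuter, Matrix.mul_add, trace_add, map_add, ← re_star_dotProduct_mulVec,
    ← re_star_dotProduct_mulVec, h]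
  ring

theorem re_star_dotProduct_hermitianOuter_self_mulVec (ψ φ : n → K) :
    re (star φ ⬝ᵥ hermitianOuter ψ ψ *ᵥ φ) = re (star ψ ⬝ᵥ hermitianOuter φ φ *ᵥ ψ) := by
  have h := re_trace_mul_comm (hermitianOuter ψ ψ) (hermitianOuter φ φ)
  rw [re_trace_mul_hermitianOuter (conjTranspose_hermitianOuter ψ ψ),
    re_trace_mul_hermitianOuter (conjTranspose_hermitianOuter φ φ)] at h
  linarith

end Matrices

section TwoSpinors

variable {K : Type} [NormedDivisionAlgebra K]

theorem traceReversal_sub (A B : Matrix (Fin 2) (Fin 2) K) :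
    traceReversal (A - B) = traceReversal A - traceReversal B := by
  have h : diagonal (fun _ : Fin 2 => (A - B).trace)
      = diagonal (fun _ => A.trace) - diagonal fun _ => B.trace := by
    rw [trace_sub, ← diagonal_sub]
  rw [traceReversal, traceReversal, traceReversal, h]
  abel

theorem traceReversal_traceReversal (A : Matrix (Fin 2) (Fin 2) K) :
    traceReversal (traceReversal A) = A := by
  ext i j
  fin_cases i <;> fin_cases j <;> simp [traceReversal, trace_fin_two, two_mul] <;> abel

theorem traceReversal_mem_hermitian2 {A : Matrix (Fin 2) (Fin 2) K} (hA : A ∈ hermitian2 K) :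
    traceReversal A ∈ hermitian2 K := by
  obtain ⟨t, x, y, rfl⟩ := exists_of_mem_hermitian2 hA
  rw [traceReversal_eq]
  exact mem_hermitian2 (-t) x y

theorem re_trace_traceReversal_mul (A B : Matrix (Fin 2) (Fin 2) K) :
    re (traceReversal A * B).trace = re (A * traceReversal B).trace := by
  simp only [traceReversal, trace_fin_two, trace_sub, sub_mul, mul_sub, add_mul, mul_add, mul_apply,
    Fin.sum_univ_two, diagonal_apply_eq, diagonal_apply_ne, ne_eq, zero_ne_one, one_ne_zero,
    not_false_eq_true, mul_zero, zero_mul, add_zero, zero_add, map_sub, map_add]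
  ring

theorem eq_zero_of_mem_hermitian2 {A : Matrix (Fin 2) (Fin 2) K} (hA : A ∈ hermitian2 K)
    (h₀ : re (A 0 0) = 0) (h₁ : re (A 1 1) = 0) (h₀₁ : A 0 1 = 0) : A = 0 := by
  have h : ∀ i j, star (A i j) = A j i := fun i j => congrFun₂ hA j i
  ext i j
  fin_cases i <;> fin_cases j
  · simpa [h₀] using eq_re_smul_one (h 0 0)
  · exact h₀₁
  · simpa [h₀₁] using (h 0 1).symm
  · simpa [h₁] using eq_re_smul_one (h 1 1)

theorem hermitianOuter_mem_hermitian2 (ψ φ : Fin 2 → K) :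
    hermitianOuter ψ φ ∈ hermitian2 K :=
  conjTranspose_hermitianOuter ψ φ

theorem traceReversal_hermitianOuter_self_mulVec (ψ : Fin 2 → K) :
    traceReversal (hermitianOuter ψ ψ) *ᵥ ψ = 0 := by
  ext i
  fin_cases i <;>
    simp [traceReversal, hermitianOuter, mulVec, dotProduct, vecMulVec_apply, add_mul,
      sub_mul, mul_star_mul_self, mul_star_self] <;> abel

/-- The vector `2 Re(ψ†φ) ψ - 2 (ψψ†)φ`. If `K` is associative it is `-2 ψ Im(ψ†φ)`, the velocity of
`ψ` under an infinitesimal phase rotation. -/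
def phaseRotation (ψ φ : Fin 2 → K) : Fin 2 → K :=
  (2 * re (star ψ ⬝ᵥ φ)) • ψ - hermitianOuter ψ ψ *ᵥ φ

theorem phaseRotation_apply (ψ φ : Fin 2 → K) (i : Fin 2) :
    phaseRotation ψ φ i = (2 : ℝ) • (re (star ψ ⬝ᵥ φ) • ψ i - ∑ k, ψ i * star (ψ k) * φ k) := by
  simp only [phaseRotation, hermitianOuter, ← two_smul ℝ (vecMulVec _ _), smul_mulVec, mulVec,
    dotProduct, vecMulVec_apply, smul_sub, mul_smul, Pi.sub_apply, Pi.smul_apply, Pi.star_apply]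

theorem hermitianOuter_phaseRotation_left (ψ φ : Fin 2 → K) :
    hermitianOuter (phaseRotation ψ φ) ψ = 0 := by
  have re_diag : ∀ i, re (phaseRotation ψ φ i * star (ψ i)) = 0 := fun i => by
    have h : ∀ k, re (ψ i * star (ψ k) * φ k * star (ψ i))
        = re (star (ψ i) * ψ i) * re (star (ψ k) * φ k) := fun k => by
      rw [re_mul_comm, ← re_mul_assoc, star_mul_mul, smul_mul_assoc, map_smul, smul_eq_mul]
    simp only [phaseRotation_apply, smul_mul_assoc, sub_mul, Fin.sum_univ_two, add_mul, map_smul,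
      map_sub, map_add, h, re_mul_comm (ψ i), dotProduct, Pi.star_apply, smul_eq_mul]
    ring
  have diag : ∀ i, re (hermitianOuter (phaseRotation ψ φ) ψ i i) = 0 := fun i => by
    rw [hermitianOuter_apply, map_add, ← re_star (ψ i * _), star_mul, star_star, re_diag, add_zero]
  refine eq_zero_of_mem_hermitian2 (hermitianOuter_mem_hermitian2 _ _) (diag 0) (diag 1) ?_
  have h₀ : ψ 0 * (star (φ 0) * (ψ 0 * star (ψ 1)))
      = (2 * re (star (ψ 0) * φ 0)) • (ψ 0 * star (ψ 1))
        - re (star (ψ 0) * ψ 0) • (φ 0 * star (ψ 1)) := by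
    rw [← mul_star_mul_add_mul_star_mul, star_mul_mul, mul_smul_comm, add_sub_cancel_right]
  have h₁ : ψ 0 * star (ψ 1) * φ 1 * star (ψ 1)
      = (2 * re (star (ψ 1) * φ 1)) • (ψ 0 * star (ψ 1))
        - re (star (ψ 1) * ψ 1) • (ψ 0 * star (φ 1)) := by
    rw [← mul_mul_star_add_mul_mul_star, mul_star_mul_self, smul_mul_assoc, add_sub_cancel_left]
  simp only [hermitianOuter_apply, phaseRotation_apply, Fin.sum_univ_two, dotProduct, Pi.star_apply,
    map_add, star_smul, star_sub, star_add, star_mul, star_star, star_trivial, smul_mul_assoc,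
    mul_smul_comm, sub_mul, mul_sub, add_mul, mul_add, h₀, h₁, mul_star_self, one_mul]
  module

theorem re_star_phaseRotation_dotProduct_mulVec {A : Matrix (Fin 2) (Fin 2) K}
    (hA : A ∈ hermitian2 K) (ψ φ : Fin 2 → K) :
    re (star (phaseRotation ψ φ) ⬝ᵥ A *ᵥ ψ) = 0 := by
  have h := re_trace_mul_hermitianOuter hA (phaseRotation ψ φ) ψ
  rw [hermitianOuter_phaseRotation_left, Matrix.mul_zero, trace_zero, map_zero] at h
  linarith

theorem re_star_phaseRotation_dotProduct (ψ φ : Fin 2 → K) :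
    re (star (phaseRotation ψ φ) ⬝ᵥ φ) = re (star (phaseRotation φ ψ) ⬝ᵥ ψ) := by
  rw [re_star_dotProduct_comm, re_star_dotProduct_comm _ ψ]
  simp only [phaseRotation, dotProduct_sub, dotProduct_smul, map_sub, map_smul, smul_eq_mul,
    re_star_dotProduct_comm φ ψ, re_star_dotProduct_hermitianOuter_self_mulVec ψ φ]

end TwoSpinors

section Vectors

theorem trace_fromBlocks {m n α : Type*} [Fintype m] [Fintype n] [AddCommMonoid α]
    (A : Matrix m m α) (B : Matrix m n α) (C : Matrix n m α) (D : Matrix n n α) :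
    (fromBlocks A B C D).trace = A.trace + D.trace := by
  simp [trace]

variable {K : Type} [NormedDivisionAlgebra K]

/-- The vector with the blocks `a`, `A~`, `A`, `-a`. -/
def blockVector (a : ℝ) (A : hermitian2 K) : Vectors K :=
  ⟨blockMatrix a A, a, A, A.2, rfl⟩

theorem coe_blockVector (a : ℝ) (A : hermitian2 K) :
    (blockVector a A : Matrix (Fin 2 ⊕ Fin 2) (Fin 2 ⊕ Fin 2) K)
      = fromBlocks (a • 1) (traceReversal A) A (-(a • 1)) := rfl

theorem exists_blockVector (M : Vectors K) : ∃ a A, M = blockVector a A := by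
  obtain ⟨_, a, A, hA, rfl⟩ := M
  exact ⟨a, ⟨A, hA⟩, rfl⟩

theorem gamma_blockVector (a : ℝ) (A : hermitian2 K) (ψ φ : Fin 2 → K) :
    gamma (blockVector a A) (Sum.elim ψ φ)
      = Sum.elim (a • ψ + traceReversal (A : Matrix (Fin 2) (Fin 2) K) *ᵥ φ)
        ((A : Matrix (Fin 2) (Fin 2) K) *ᵥ ψ - a • φ) := by
  rw [gamma_apply, coe_blockVector, fromBlocks_mulVec, Sum.elim_comp_inl,
    Sum.elim_comp_inr, neg_mulVec, smul_mulVec, smul_mulVec, one_mulVec, one_mulVec,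
    ← sub_eq_add_neg]

theorem spinorForm_elim (ψ φ ψ' φ' : Fin 2 → K) :
    spinorForm (Sum.elim ψ φ) (Sum.elim ψ' φ') = re (star φ ⬝ᵥ ψ') - re (star ψ ⬝ᵥ φ') := by
  have h : star (Sum.elim ψ φ) = Sum.elim (star ψ) (star φ) := by
    ext (i | i) <;> rfl
  simp only [spinorForm, LinearMap.mk₂_apply, gammaZero, fromBlocks_mulVec, Sum.elim_comp_inl,
    Sum.elim_comp_inr, zero_mulVec, neg_mulVec, one_mulVec, h, sumElim_dotProduct_sumElim,
    zero_add, add_zero, dotProduct_neg, map_add, map_neg]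
  ring

theorem spinorForm_neg_comm (Ψ Φ : Spinors K) : -spinorForm Ψ Φ = spinorForm Φ Ψ := by
  rw [← Sum.elim_comp_inl_inr Ψ, ← Sum.elim_comp_inl_inr Φ, spinorForm_elim, spinorForm_elim,
    re_star_dotProduct_comm (Φ ∘ Sum.inr), re_star_dotProduct_comm (Φ ∘ Sum.inl)]
  ring

theorem spinorForm_gamma_left (M : Vectors K) (Ψ Φ : Spinors K) :
    spinorForm (gamma M Ψ) Φ = -spinorForm Ψ (gamma M Φ) := by
  rw [spinorForm_gamma_comm, spinorForm_neg_comm]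

theorem metric_blockVector (a b : ℝ) (A B : hermitian2 K) :
    metric (blockVector a A) (blockVector b B)
      = a * b + 1 / 2 * re (traceReversal (A : Matrix (Fin 2) (Fin 2) K) * B).trace := by
  have re_trace_one : re (1 : Matrix (Fin 2) (Fin 2) K).trace = 2 := by
    rw [trace_fin_two, one_apply_eq, one_apply_eq, map_add, re_one, one_add_one_eq_two]
  simp only [metric, LinearMap.mk₂_apply, coe_blockVector, fromBlocks_multiply, trace_fromBlocks,
    trace_add, map_add, ← re_trace_traceReversal_mul]
  simp only [mul_smul_one, trace_smul, map_smul, smul_eq_mul, re_trace_one, mul_neg, smul_neg,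
    neg_neg]
  ring

theorem spinorDot_elim (ψ φ ψ' φ' : Fin 2 → K) :
    spinorDot (Sum.elim ψ φ) (Sum.elim ψ' φ')
      = blockVector (re (star ψ ⬝ᵥ φ') + re (star φ ⬝ᵥ ψ'))
        ⟨hermitianOuter φ φ' - traceReversal (hermitianOuter ψ ψ'),
          sub_mem (hermitianOuter_mem_hermitian2 _ _)
            (traceReversal_mem_hermitian2 (hermitianOuter_mem_hermitian2 _ _))⟩ := by
  refine sub_eq_zero.1 (metric_separatingLeft _ fun M => ?_)
  obtain ⟨b, B, rfl⟩ := exists_blockVector M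
  rw [map_sub, LinearMap.sub_apply, metric_spinorDot, metric_blockVector, gamma_blockVector,
    spinorForm_elim, traceReversal_sub, traceReversal_traceReversal, Matrix.sub_mul, trace_sub,
    map_sub, re_trace_traceReversal_mul, re_trace_mul_comm, re_trace_mul_comm _ B.1,
    re_trace_mul_hermitianOuter (traceReversal_mem_hermitian2 B.2),
    re_trace_mul_hermitianOuter B.2, dotProduct_add, dotProduct_sub, dotProduct_smul,
    dotProduct_smul, map_add, map_sub, map_smul, map_smul, smul_eq_mul, smul_eq_mul]
  ring

theorem gamma_spinorDot_self (ψ φ : Fin 2 → K) :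
    gamma (spinorDot (Sum.elim ψ φ) (Sum.elim ψ φ)) (Sum.elim ψ φ)
      = Sum.elim (phaseRotation ψ φ) (-phaseRotation φ ψ) := by
  rw [spinorDot_elim, gamma_blockVector, traceReversal_sub, traceReversal_traceReversal, sub_mulVec,
    sub_mulVec, traceReversal_hermitianOuter_self_mulVec, traceReversal_hermitianOuter_self_mulVec,
    phaseRotation, phaseRotation, re_star_dotProduct_comm φ ψ, ← two_mul, zero_sub, sub_zero,
    neg_sub, ← sub_eq_add_neg]

theorem spinorForm_gamma_spinorDot_self (Ψ : Spinors K) (M : Vectors K) :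
    spinorForm (gamma (spinorDot Ψ Ψ) Ψ) (gamma M Ψ) = 0 := by
  obtain ⟨a, A, rfl⟩ := exists_blockVector M
  rw [← Sum.elim_comp_inl_inr Ψ]
  generalize Ψ ∘ Sum.inl = ψ, Ψ ∘ Sum.inr = φ
  rw [gamma_spinorDot_self, gamma_blockVector, spinorForm_elim, star_neg, neg_dotProduct, map_neg,
    dotProduct_add, dotProduct_sub, dotProduct_smul, dotProduct_smul, map_add, map_sub, map_smul,
    map_smul, re_star_phaseRotation_dotProduct_mulVec A.2,
    re_star_phaseRotation_dotProduct_mulVec (traceReversal_mem_hermitian2 A.2),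
    re_star_phaseRotation_dotProduct ψ φ]
  ring

end Vectors

section Dimension

variable {K : Type} [NormedDivisionAlgebra K]

theorem coe_vec (a t x : ℝ) (y : K) :
    (vec a t x y : Matrix (Fin 2 ⊕ Fin 2) (Fin 2 ⊕ Fin 2) K)
      = blockMatrix a !![(t + x) • 1, y; star y, (t - x) • 1] := rfl

/-- The components `a`, `t`, `x`, `y` of the vector `vec a t x y` as linear coordinates on `𝒱`. -/
noncomputable def vecCoordinates : Vectors K ≃ₗ[ℝ] ℝ × ℝ × ℝ × K where
  toFun M :=
    (re (M.1 (.inl 0) (.inl 0)),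
      (1 / 2 : ℝ) * (re (M.1 (.inr 0) (.inl 0)) + re (M.1 (.inr 1) (.inl 1))),
      (1 / 2 : ℝ) * (re (M.1 (.inr 0) (.inl 0)) - re (M.1 (.inr 1) (.inl 1))),
      M.1 (.inr 0) (.inl 1))
  invFun v := vec v.1 v.2.1 v.2.2.1 v.2.2.2
  map_add' M N := by
    ext <;> simp only [Submodule.coe_add, Matrix.add_apply, map_add, Prod.mk_add_mk] <;> ring
  map_smul' r M := by
    ext <;> simp only [SetLike.val_smul, Matrix.smul_apply, map_smul, smul_eq_mul,
      Prod.smul_mk, RingHom.id_apply] <;> ring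
  left_inv M := by
    obtain ⟨a, t, x, y, rfl⟩ := exists_vec M
    simp [coe_vec, blockMatrix, re_one, ← two_mul]
  right_inv v := by
    ext <;> simp [coe_vec, blockMatrix, re_one] <;> ring

theorem finrank_vectors (K : Type) [NormedDivisionAlgebra K] :
    Module.finrank ℝ (Vectors K) = Module.finrank ℝ K + 3 := by
  rw [vecCoordinates.finrank_eq]
  simp only [Module.finrank_prod, Module.finrank_self]
  ring

theorem IsSpacetimeAlgebra.finrank_add_three {D : ℕ} {K : Type} [NormedDivisionAlgebra K]
    (hK : IsSpacetimeAlgebra D K) : Module.finrank ℝ K + 3 = D := by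
  cases hK with
  | real => rw [Module.finrank_self]
  | complex => rw [Complex.finrank_real_complex]
  | quaternion => rw [Quaternion.finrank_eq_four]
  | octonion =>
    have h : Module.finrank ℝ Octonion = Module.finrank ℝ (ℍ[ℝ] × ℍ[ℝ]) := rfl
    rw [h, Module.finrank_prod, Quaternion.finrank_eq_four]

end Dimension

section Polarization

variable {R S V : Type*} [CommRing R] [NoZeroDivisors R] [NeZero (2 : R)]
  [AddCommGroup S] [Module R S] [AddCommGroup V] [Module R V]
  {T : S →ₗ[R] S →ₗ[R] V →ₗ[R] R} {D : S →ₗ[R] S →ₗ[R] V}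

theorem polarize_quartic_partial (hT : ∀ x y v, T x y v = T y x v) (hD : ∀ x y, D x y = D y x)
    (h : ∀ x, T x x (D x x) = 0) (x y z : S) :
    T x y (D z z) + T z z (D x y) + 2 * T x z (D y z) + 2 * T y z (D x z) = 0 := by
  have h₂ (x : S) : T x x (D z z) + T z z (D x x) + 4 * T x z (D x z) = 0 := by
    refine (mul_eq_zero.1 ?_).resolve_left (two_ne_zero (α := R))
    have e₁ := h (x + z)
    have e₂ := h (x - z)
    simp only [map_add, map_sub, LinearMap.add_apply, LinearMap.sub_apply, hT z x, hD z x] at e₁ e₂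
    linear_combination e₁ + e₂ - 2 * h x - 2 * h z
  refine (mul_eq_zero.1 ?_).resolve_left (two_ne_zero (α := R))
  have e := h₂ (x + y)
  simp only [map_add, LinearMap.add_apply, hT y x, hD y x] at e
  linear_combination e - h₂ x - h₂ y

theorem polarize_quartic (hT : ∀ x y v, T x y v = T y x v) (hD : ∀ x y, D x y = D y x)
    (h : ∀ x, T x x (D x x) = 0) (x y z w : S) :
    T x y (D z w) + T x z (D y w) + T x w (D y z) + T y z (D x w) + T y w (D x z)
      + T z w (D x y) = 0 := by
  refine (mul_eq_zero.1 ?_).resolve_left (two_ne_zero (α := R))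
  have e := polarize_quartic_partial hT hD h x y (z + w)
  simp only [map_add, LinearMap.add_apply, hT w z, hD w z] at e
  linear_combination e - polarize_quartic_partial hT hD h x y z
    - polarize_quartic_partial hT hD h x y w

end Polarization

section LieSuperalgebra

variable {L : Type*} [AddCommGroup L] [Module ℝ L] [LieSuperalgebra L]

theorem koszul_zero_left (j : ZMod 2) : koszul 0 j = 1 := by simp [koszul]

theorem koszul_zero_right (i : ZMod 2) : koszul i 0 = 1 := by simp [koszul]

theorem koszul_one_one : koszul 1 1 = -1 := by simp [koszul, ZMod.val_one]

theorem koszul_ne_zero (i j : ZMod 2) : koszul i j ≠ 0 := by simp [koszul]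

theorem bracket_comm_of_odd {x y : L} (hx : x ∈ part 1) (hy : y ∈ part 1) :
    bracket x y = (bracket y x : L) := by
  rw [bracket_skew hx hy, koszul_one_one, neg_one_smul, neg_neg]

theorem multilinear_eq_zero_of_homogeneous {n : ℕ} {ω : MultilinearMap ℝ (fun _ : Fin n => L) ℝ}
    (h : ∀ (p : Fin n → ZMod 2) (X : Fin n → L), (∀ k, X k ∈ part (p k)) → ω X = 0) :
    ω = 0 := by
  ext X
  choose Y Z hY hZ hYZ using fun k =>
    Submodule.codisjoint_iff_exists_add_eq.1 (isCompl (L := L)).codisjoint (X k)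
  obtain rfl : Y + Z = X := funext hYZ
  rw [MultilinearMap.map_add_univ]
  refine Finset.sum_eq_zero fun s _ => h (fun k => if k ∈ s then 0 else 1) _ fun k => ?_
  by_cases hk : k ∈ s <;> simp [hk, hY, hZ]

/-- `ω` vanishes at all homogeneous elements with the parities `s`, in this order. -/
def VanishesAt {n : ℕ} (ω : Cochain L n) (s : Fin n → ZMod 2) : Prop :=
  ∀ X : Fin n → L, (∀ k, X k ∈ part (s k)) → ω.1 X = 0

theorem VanishesAt.comp_swap {n : ℕ} {ω : Cochain L n} {s : Fin n → ZMod 2}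
    (h : VanishesAt ω s) {i j : Fin n} (hij : (i : ℕ) + 1 = j) :
    VanishesAt ω (s ∘ Equiv.swap i j) := fun X hX => by
  have hX' : ∀ k, (X ∘ Equiv.swap i j) k ∈ part (s k) := fun k => by
    simpa using hX (Equiv.swap i j k)
  have h' := h _ hX'
  rw [ω.2 _ X hX i j hij, neg_eq_zero] at h'
  exact (mul_eq_zero.1 h').resolve_left (koszul_ne_zero _ _)

theorem VanishesAt.comp_perm {n : ℕ} {ω : Cochain L n} {s : Fin n → ZMod 2}
    (h : VanishesAt ω s) (σ : Equiv.Perm (Fin n)) : VanishesAt ω (s ∘ σ) := by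
  obtain _ | n := n
  · rwa [Subsingleton.elim σ 1]
  have hσ : σ ∈ Submonoid.closure (Set.range fun i : Fin n => Equiv.swap i.castSucc i.succ) := by
    rw [Equiv.Perm.mclosure_swap_castSucc_succ]
    trivial
  induction hσ using Submonoid.closure_induction_right with
  | one => exact h
  | mul_right τ _ _ hi hτ =>
    obtain ⟨i, rfl⟩ := hi
    exact hτ.comp_swap rfl

theorem exists_perm_comp_eq {n : Type*} [Fintype n] {s t : n → ZMod 2}
    (h : (Finset.univ.filter fun k => s k = 1).card = (Finset.univ.filter fun k => t k = 1).card) :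
    ∃ σ : Equiv.Perm n, s ∘ σ = t := by
  classical
  rw [← Fintype.card_subtype, ← Fintype.card_subtype] at h
  let e : {k // t k = 1} ≃ {k // s k = 1} := Fintype.equivOfCardEq h.symm
  have ne_one : ∀ i : ZMod 2, i ≠ 1 → i = 0 := by decide
  refine ⟨e.extendSubtype, funext fun k => ?_⟩
  by_cases hk : t k = 1
  · rw [Function.comp_apply, e.extendSubtype_mem k hk, hk]
  · rw [Function.comp_apply, ne_one _ hk, ne_one _ (e.extendSubtype_not_mem k hk)]

theorem IsForm.eq_zero_of_vanishesAt {p q : ℕ} {ω : Cochain L (p + q)}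
    (hω : IsForm p q ω) {s : Fin (p + q) → ZMod 2}
    (hs : (Finset.univ.filter fun k => s k = 1).card = q) (h : VanishesAt ω s) : ω = 0 := by
  refine Subtype.ext (multilinear_eq_zero_of_homogeneous fun t X hX => ?_)
  by_cases ht : (Finset.univ.filter fun k => t k = 1).card = q
  · obtain ⟨σ, rfl⟩ := exists_perm_comp_eq (hs.trans ht.symm)
    exact h.comp_perm σ X hX
  · exact hω t X hX ht

theorem IsForm.sub {p q : ℕ} {ω η : Cochain L (p + q)} (hω : IsForm p q ω) (hη : IsForm p q η) :
    IsForm p q (ω - η) := fun s X hX hs => by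
  rw [Submodule.coe_sub, _root_.sub_apply, hω s X hX hs, hη s X hX hs, sub_zero]

theorem sum_parity_eq_card {n : ℕ} (s : Fin n → ZMod 2) :
    ∑ k, s k = ((Finset.univ.filter fun k => s k = 1).card : ZMod 2) := by
  have h : ∀ i : ZMod 2, i = if i = 1 then 1 else 0 := by decide
  rw [Finset.card_filter, Nat.cast_sum]
  exact Finset.sum_congr rfl fun k _ => (h (s k)).trans (by push_cast; rfl)

theorem IsForm.isEvenCochain {p q : ℕ} {ω : Cochain L (p + q)} (hω : IsForm p q ω) (hq : Even q) :
    IsEvenCochain ω := fun s X hX hs => hω s X hX fun h => by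
  rw [sum_parity_eq_card, h, hq.natCast_zmod_two] at hs
  exact zero_ne_one hs

end LieSuperalgebra

section Shuffle

variable {L : Type*} [AddCommGroup L] [Module ℝ L]

/-- The super-skew-symmetrization of `T`: the signed sum over the ways to distribute four arguments
over the two odd and the two even slots of `T`. -/
def shuffleForm (T : L →ₗ[ℝ] L →ₗ[ℝ] L →ₗ[ℝ] L →ₗ[ℝ] ℝ) :
    MultilinearMap ℝ (fun _ : Fin 4 => L) ℝ :=
  MultilinearMap.mk' (fun X => T (X 0) (X 1) (X 2) (X 3) - T (X 0) (X 2) (X 1) (X 3)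
      + T (X 0) (X 3) (X 1) (X 2) + T (X 1) (X 2) (X 0) (X 3) - T (X 1) (X 3) (X 0) (X 2)
      + T (X 2) (X 3) (X 0) (X 1))
    (fun X i x y => by fin_cases i <;> simp [Function.update] <;> ring)
    (fun X i c x => by fin_cases i <;> simp [Function.update] <;> ring)

theorem shuffleForm_apply (T : L →ₗ[ℝ] L →ₗ[ℝ] L →ₗ[ℝ] L →ₗ[ℝ] ℝ) (X : Fin 4 → L) :
    shuffleForm T X = T (X 0) (X 1) (X 2) (X 3) - T (X 0) (X 2) (X 1) (X 3)
      + T (X 0) (X 3) (X 1) (X 2) + T (X 1) (X 2) (X 0) (X 3) - T (X 1) (X 3) (X 0) (X 2)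
      + T (X 2) (X 3) (X 0) (X 1) := rfl

variable [LieSuperalgebra L]

theorem coboundary_eq_zero_of_bracket {n : ℕ} (ω : MultilinearMap ℝ (fun _ : Fin (n + 1) => L) ℝ)
    (p : Fin (n + 2) → ZMod 2) {X : Fin (n + 2) → L} (h : ∀ i j, i < j → bracket (X i) (X j) = 0) :
    coboundary ω p X = 0 := by
  refine Finset.sum_eq_zero fun j _ => Finset.sum_eq_zero fun i _ => ?_
  split_ifs with hij
  · rw [h _ _ hij, ω.map_coord_zero 0 rfl, mul_zero]
  · rfl

theorem IsExactCochain.apply_eq_zero {n : ℕ} {η : Cochain L (n + 2)} (hη : IsExactCochain η)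
    {p : Fin (n + 2) → ZMod 2} {X : Fin (n + 2) → L} (hX : ∀ k, X k ∈ part (p k))
    (h : ∀ i j, i < j → bracket (X i) (X j) = 0) : η.1 X = 0 := by
  obtain ⟨θ, hθ⟩ := hη
  rw [hθ p X hX, coboundary_eq_zero_of_bracket θ.1 p h]

theorem card_odd_removeNth {n : ℕ} (s : Fin (n + 1) → ZMod 2) (j : Fin (n + 1)) :
    (Finset.univ.filter fun k => s k = 1).card
      = (if s j = 1 then 1 else 0) + (Finset.univ.filter fun k => j.removeNth s k = 1).card := by
  rw [Finset.card_filter, Finset.card_filter, Fin.sum_univ_succAbove _ j]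
  rfl

theorem bracket_eq_zero_of_not_odd (h₀ : ∀ x ∈ (part 0 : Submodule ℝ L), bracket x = 0)
    {i j : ZMod 2} (hij : ¬(i = 1 ∧ j = 1)) {x y : L} (hx : x ∈ part i) (hy : y ∈ part j) :
    bracket x y = 0 := by
  obtain rfl | rfl := parity_cases i
  · rw [h₀ x hx, LinearMap.zero_apply]
  obtain rfl | rfl := parity_cases j
  · rw [bracket_skew hx hy, h₀ y hy, LinearMap.zero_apply, smul_zero, neg_zero]
  · exact absurd ⟨rfl, rfl⟩ hij

theorem bracket_mem_even (h₀ : ∀ x ∈ (part 0 : Submodule ℝ L), bracket x = 0)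
    {i j : ZMod 2} {x y : L} (hx : x ∈ part i) (hy : y ∈ part j) : bracket x y ∈ part 0 := by
  by_cases hij : i = 1 ∧ j = 1
  · obtain ⟨rfl, rfl⟩ := hij
    exact bracket_mem hx hy
  · rw [bracket_eq_zero_of_not_odd h₀ hij hx hy]
    exact zero_mem _

theorem coboundary_eq_zero_of_card_odd_ne {n q : ℕ}
    (h₀ : ∀ x ∈ (part 0 : Submodule ℝ L), bracket x = 0)
    {ω : MultilinearMap ℝ (fun _ : Fin (n + 1) => L) ℝ}
    (hω : ∀ (s : Fin (n + 1) → ZMod 2) (X : Fin (n + 1) → L), (∀ k, X k ∈ part (s k)) →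
      (Finset.univ.filter fun k => s k = 1).card ≠ q → ω X = 0)
    {s : Fin (n + 2) → ZMod 2} {X : Fin (n + 2) → L} (hX : ∀ k, X k ∈ part (s k))
    (hs : (Finset.univ.filter fun k => s k = 1).card ≠ q + 2) : coboundary ω s X = 0 := by
  refine Finset.sum_eq_zero fun j _ => Finset.sum_eq_zero fun i _ => ?_
  split_ifs with hij
  · by_cases h : s i.castSucc = 1 ∧ s j = 1
    · rw [hω (Fin.cons 0 (i.removeNth (j.removeNth s))), mul_zero]
      · refine Fin.cases ?_ fun k => ?_
        · exact bracket_mem_even h₀ (hX _) (hX _)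
        · exact hX _
      · have hi : j.removeNth s i = 1 := by
          rw [Fin.removeNth, Fin.succAbove_of_castSucc_lt _ _ hij, h.1]
        rw [card_odd_removeNth s j, card_odd_removeNth _ i, if_pos h.2, if_pos hi] at hs
        rw [card_odd_removeNth _ 0, Fin.removeNth_zero, Fin.tail_cons, Fin.cons_zero,
          if_neg zero_ne_one]
        omega
    · rw [bracket_eq_zero_of_not_odd h₀ h (hX _) (hX _), ω.map_coord_zero 0 rfl, mul_zero]
  · rfl

theorem cons_removeNth_removeNth {α : Type*} (u : α) (X : Fin 5 → α) (i : Fin 4) (j : Fin 5)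
    {a b c : Fin 5} (h : j.succAbove (i.succAbove 0) = a ∧ j.succAbove (i.succAbove 1) = b ∧
      j.succAbove (i.succAbove 2) = c) :
    (Fin.cons u (i.removeNth (j.removeNth X)) : Fin 4 → α) = ![u, X a, X b, X c] := by
  obtain ⟨rfl, rfl, rfl⟩ := h
  ext k
  fin_cases k <;> rfl

theorem coboundary_four (ω : MultilinearMap ℝ (fun _ : Fin 4 => L) ℝ) (p : Fin 5 → ZMod 2)
    (X : Fin 5 → L) : coboundary ω p X =
      -(koszul (p 0) (p 1) * moveSign p 0 * moveSign p 1 *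
        ω ![bracket (X 0) (X 1), X 2, X 3, X 4]) +
      koszul (p 0) (p 2) * moveSign p 0 * moveSign p 2 *
        ω ![bracket (X 0) (X 2), X 1, X 3, X 4] -
      koszul (p 0) (p 3) * moveSign p 0 * moveSign p 3 *
        ω ![bracket (X 0) (X 3), X 1, X 2, X 4] +
      koszul (p 0) (p 4) * moveSign p 0 * moveSign p 4 *
        ω ![bracket (X 0) (X 4), X 1, X 2, X 3] -
      koszul (p 1) (p 2) * moveSign p 1 * moveSign p 2 *
        ω ![bracket (X 1) (X 2), X 0, X 3, X 4] +
      koszul (p 1) (p 3) * moveSign p 1 * moveSign p 3 *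
        ω ![bracket (X 1) (X 3), X 0, X 2, X 4] -
      koszul (p 1) (p 4) * moveSign p 1 * moveSign p 4 *
        ω ![bracket (X 1) (X 4), X 0, X 2, X 3] -
      koszul (p 2) (p 3) * moveSign p 2 * moveSign p 3 *
        ω ![bracket (X 2) (X 3), X 0, X 1, X 4] +
      koszul (p 2) (p 4) * moveSign p 2 * moveSign p 4 *
        ω ![bracket (X 2) (X 4), X 0, X 1, X 3] -
      koszul (p 3) (p 4) * moveSign p 3 * moveSign p 4 *
        ω ![bracket (X 3) (X 4), X 0, X 1, X 2] := by
  have e (i j a b c h) := fun u => cons_removeNth_removeNth u X i j (a := a) (b := b) (c := c) h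
  simp only [coboundary, Nat.reduceAdd, Fin.sum_univ_five, Fin.sum_univ_four, Fin.isValue,
    Fin.reduceCastSucc, Fin.reduceLT, ↓reduceIte, e 0 1 2 3 4 (by decide),
    e 0 2 1 3 4 (by decide), e 0 3 1 2 4 (by decide), e 0 4 1 2 3 (by decide),
    e 1 2 0 3 4 (by decide), e 1 3 0 2 4 (by decide), e 1 4 0 2 3 (by decide),
    e 2 3 0 1 4 (by decide), e 2 4 0 1 3 (by decide), e 3 4 0 1 2 (by decide),
    Fin.coe_ofNat_eq_mod, Nat.reduceMod, not_lt_zero]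
  ring

/-- `T` is a pairing of two odd and two even elements, symmetric in the odd and alternating in the
even ones, extended by zero to all of `L`. Such pairings are the restrictions of `(2, 2)`-forms to
two odd elements followed by two even ones. -/
structure IsOddOddEvenEven (T : L →ₗ[ℝ] L →ₗ[ℝ] L →ₗ[ℝ] L →ₗ[ℝ] ℝ) : Prop where
  odd_comm : ∀ x y a b, T x y a b = T y x a b
  even_neg_comm : ∀ x y a b, -T x y a b = T x y b a
  apply_even : ∀ x ∈ part 0, T x = 0
  apply_odd : ∀ x y, ∀ a ∈ part 1, T x y a = 0

namespace IsOddOddEvenEven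

variable {T : L →ₗ[ℝ] L →ₗ[ℝ] L →ₗ[ℝ] L →ₗ[ℝ] ℝ}

theorem apply_apply_even (hT : IsOddOddEvenEven T) (x : L) {y : L} (hy : y ∈ part 0) :
    T x y = 0 := by
  ext a b
  rw [hT.odd_comm, hT.apply_even y hy]
  rfl

theorem apply_odd_right (hT : IsOddOddEvenEven T) (x y a : L) {b : L} (hb : b ∈ part 1) :
    T x y a b = 0 := by
  rw [← hT.even_neg_comm, hT.apply_odd x y b hb, LinearMap.zero_apply, neg_zero]

theorem shuffleForm_mem_cochain (hT : IsOddOddEvenEven T) : shuffleForm T ∈ Cochain L 4 := by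
  intro s X hX i j hij
  have h₀ : ∀ k, s k = 0 → X k ∈ part 0 := fun k hk => hk ▸ hX k
  have h₁ : ∀ k, s k = 1 → X k ∈ part 1 := fun k hk => hk ▸ hX k
  have even₁ := fun k hk => hT.apply_even _ (h₀ k hk)
  have even₂ := fun x k hk => hT.apply_apply_even x (h₀ k hk)
  have odd₃ := fun x y k hk => hT.apply_odd x y _ (h₁ k hk)
  have odd₄ := fun x y a k hk => hT.apply_odd_right x y a (h₁ k hk)
  rw [shuffleForm_apply, shuffleForm_apply]
  have hij' : (i = 0 ∧ j = 1) ∨ (i = 1 ∧ j = 2) ∨ (i = 2 ∧ j = 3) := by omega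
  rcases parity_cases (s i) with hi | hi <;> rcases parity_cases (s j) with hj | hj <;>
    obtain ⟨rfl, rfl⟩ | ⟨rfl, rfl⟩ | ⟨rfl, rfl⟩ := hij' <;>
    simp only [hi, hj, even₁, even₂, odd₃, odd₄, koszul_zero_left, koszul_zero_right,
      koszul_one_one, Function.comp_apply, Equiv.swap_apply_left, Equiv.swap_apply_right,
      Equiv.swap_apply_of_ne_of_ne, ne_eq, Fin.reduceEq, not_false_eq_true, LinearMap.zero_apply]
  all_goals grind [hT.odd_comm, hT.even_neg_comm]

variable (hT : IsOddOddEvenEven T)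
include hT

/-- `shuffleForm T` as a cochain. -/
def shuffleCochain : Cochain L 4 := ⟨shuffleForm T, hT.shuffleForm_mem_cochain⟩

theorem shuffleCochain_apply_even_even (x y : L) {a b : L} (ha : a ∈ part 0)
    (hb : b ∈ part 0) : hT.shuffleCochain.1 ![x, y, a, b] = T x y a b := by
  simp [shuffleCochain, shuffleForm_apply, hT.apply_even a ha, hT.apply_apply_even _ ha,
    hT.apply_apply_even _ hb]

theorem shuffleForm_even_cons {b : L} (hb : b ∈ part 0) (x y z : L) :
    shuffleForm T ![b, x, y, z] = T x y b z - T x z b y + T y z b x := by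
  simp [shuffleForm_apply, hT.apply_even b hb]

theorem apply_eq_zero {i j k l : ZMod 2} {x y a b : L} (hx : x ∈ part i) (hy : y ∈ part j)
    (ha : a ∈ part k) (hb : b ∈ part l) (h : ¬(i = 1 ∧ j = 1 ∧ k = 0 ∧ l = 0)) :
    T x y a b = 0 := by
  obtain rfl | rfl := parity_cases i
  · rw [hT.apply_even x hx]; rfl
  obtain rfl | rfl := parity_cases j
  · rw [hT.apply_apply_even x hy]; rfl
  obtain rfl | rfl := parity_cases k
  · obtain rfl | rfl := parity_cases l
    · exact absurd ⟨rfl, rfl, rfl, rfl⟩ h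
    · exact hT.apply_odd_right x y a hb
  · rw [hT.apply_odd x y a ha]; rfl

theorem isForm_shuffleCochain : IsForm 2 2 hT.shuffleCochain := by
  intro s X hX hs
  have hT₀ (i j k l : Fin 4) (h : ∀ s : Fin 4 → ZMod 2, s i = 1 ∧ s j = 1 ∧ s k = 0 ∧ s l = 0 →
      (Finset.univ.filter fun k => s k = 1).card = 2) : T (X i) (X j) (X k) (X l) = 0 :=
    hT.apply_eq_zero (hX i) (hX j) (hX k) (hX l) (mt (h s) hs)
  change shuffleForm T X = 0
  rw [shuffleForm_apply, hT₀ 0 1 2 3 (by decide), hT₀ 0 2 1 3 (by decide), hT₀ 0 3 1 2 (by decide),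
    hT₀ 1 2 0 3 (by decide), hT₀ 1 3 0 2 (by decide), hT₀ 2 3 0 1 (by decide)]
  simp only [sub_zero, add_zero]

theorem sum_apply_bracket_eq_zero {x y z w a : L} (h : ∀ x ∈ part 1, T x x a (bracket x x) = 0)
    (hx : x ∈ part 1) (hy : y ∈ part 1) (hz : z ∈ part 1) (hw : w ∈ part 1) :
    T x y (bracket z w) a + T x z (bracket y w) a + T x w (bracket y z) a
      + T y z (bracket x w) a + T y w (bracket x z) a + T z w (bracket x y) a = 0 := by
  have e := polarize_quartic
    (T := (T.domRestrict₁₂ (part 1) (part 1)).compr₂ (LinearMap.applyₗ a))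
    (D := bracket.domRestrict₁₂ (part 1) (part 1)) (fun x y v => hT.odd_comm x y a v)
    (fun x y => bracket_comm_of_odd x.2 y.2) (fun x => h x x.2) ⟨x, hx⟩ ⟨y, hy⟩ ⟨z, hz⟩ ⟨w, hw⟩
  simp only [LinearMap.compr₂_apply, LinearMap.domRestrict₁₂_apply, LinearMap.applyₗ_apply_apply,
    ← hT.even_neg_comm _ _ _ a] at e
  linear_combination -e

theorem isClosedCochain_shuffleCochain (h₀ : ∀ x ∈ (part 0 : Submodule ℝ L), bracket x = 0)
    (h : ∀ x ∈ part 1, ∀ a ∈ part 0, T x x a (bracket x x) = 0) :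
    IsClosedCochain hT.shuffleCochain := by
  intro s X hX
  by_cases hs : (Finset.univ.filter fun k => s k = 1).card = 4
  swap
  · exact coboundary_eq_zero_of_card_odd_ne h₀ hT.isForm_shuffleCochain hX hs
  obtain ⟨k, rfl⟩ : ∃ k, s = Function.update (1 : Fin 5 → ZMod 2) k 0 :=
    (by decide : ∀ s : Fin 5 → ZMod 2, (Finset.univ.filter fun k => s k = 1).card = 4 →
      ∃ k, s = Function.update (1 : Fin 5 → ZMod 2) k 0) s hs
  have hk : X k ∈ part 0 := by simpa using hX k
  have hodd : ∀ i, i ≠ k → X i ∈ part 1 := fun i hi => by simpa [hi] using hX i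
  have hb : ∀ i j, bracket (X i) (X j) ∈ part 0 := fun i j => bracket_mem_even h₀ (hX i) (hX j)
  have even₁ := hT.apply_even _ hk
  have even₂ := fun x => hT.apply_apply_even x hk
  have bracket_left := h₀ _ hk
  have bracket_right := fun i => bracket_eq_zero_of_not_odd h₀ (by simp) (hX i) hk
  have quartic := fun x y z w hx hy hz hw => hT.sum_apply_bracket_eq_zero (fun x hx => h x hx _ hk)
    (hodd x hx) (hodd y hy) (hodd z hz) (hodd w hw)
  rw [coboundary_four]
  simp only [shuffleCochain, hT.shuffleForm_even_cons (hb _ _), moveSign, Finset.prod_filter,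
    Fin.prod_univ_five]
  obtain rfl | rfl | rfl | rfl | rfl : k = 0 ∨ k = 1 ∨ k = 2 ∨ k = 3 ∨ k = 4 := by omega
  all_goals simp only [bracket_left, bracket_right, even₁, even₂, map_zero, LinearMap.zero_apply,
    Function.update_self, Function.update_of_ne, Pi.one_apply, koszul_zero_left, koszul_zero_right,
    koszul_one_one, ne_eq, Fin.isValue, Fin.reduceEq, Fin.reduceLT, Fin.lt_one_iff, zero_ne_one,
    one_ne_zero, lt_self_iff_false, not_lt_zero, zero_lt_one, not_false_eq_true, ↓reduceIte]
  · linear_combination -quartic 1 2 3 4 (by decide) (by decide) (by decide) (by decide)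
  · linear_combination quartic 0 2 3 4 (by decide) (by decide) (by decide) (by decide)
  · linear_combination -quartic 0 1 3 4 (by decide) (by decide) (by decide) (by decide)
  · linear_combination quartic 0 1 2 4 (by decide) (by decide) (by decide) (by decide)
  · linear_combination -quartic 0 1 2 3 (by decide) (by decide) (by decide) (by decide)

end IsOddOddEvenEven

end Shuffle

section Supertranslation

variable {K : Type} [NormedDivisionAlgebra K]

/-- The four-linear form `⟨Ψ, (𝒜ℬ - ℬ𝒜) Φ⟩`, where `Ψ` and `Φ` are the spinor parts of the first two
arguments and `𝒜` and `ℬ` are the vector parts of the last two. -/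
def commutatorForm : Supertranslation K →ₗ[ℝ] Supertranslation K →ₗ[ℝ] Supertranslation K →ₗ[ℝ]
    Supertranslation K →ₗ[ℝ] ℝ :=
  LinearMap.mk₂ ℝ
    (fun x y => LinearMap.mk₂ ℝ
      (fun a b => spinorForm x.2 (gamma a.1 (gamma b.1 y.2) - gamma b.1 (gamma a.1 y.2)))
      (fun a a' b => by simp only [Prod.fst_add, map_add, LinearMap.add_apply, map_sub]; ring)
      (fun r a b => by
        simp only [Prod.smul_fst, map_smul, LinearMap.smul_apply, map_sub, smul_eq_mul]; ring)
      (fun a b b' => by simp only [Prod.fst_add, map_add, LinearMap.add_apply, map_sub]; ring)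
      (fun r a b => by
        simp only [Prod.smul_fst, map_smul, LinearMap.smul_apply, map_sub, smul_eq_mul]; ring))
    (fun x x' y => LinearMap.ext₂ fun a b => by simp)
    (fun r x y => LinearMap.ext₂ fun a b => by simp)
    (fun x y y' => LinearMap.ext₂ fun a b => by
      simp only [Prod.snd_add, map_add, map_sub, LinearMap.mk₂_apply, LinearMap.add_apply]; ring)
    (fun r x y => LinearMap.ext₂ fun a b => by
      simp only [Prod.smul_snd, map_smul, map_sub, smul_eq_mul, LinearMap.mk₂_apply,
        LinearMap.smul_apply]; ring)

theorem commutatorForm_apply (x y a b : Supertranslation K) : commutatorForm x y a b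
    = spinorForm x.2 (gamma a.1 (gamma b.1 y.2) - gamma b.1 (gamma a.1 y.2)) := rfl

theorem spinorForm_cliffordCommutator (Ψ Φ : Spinors K) (A B : Vectors K) :
    spinorForm Ψ (cliffordAction (cliffordCommutator A B) Φ)
      = commutatorForm (0, Ψ) (0, Φ) (A, 0) (B, 0) := by
  simp [cliffordAction, cliffordCommutator, commutatorForm_apply]

theorem spinorForm_gamma_gamma (Ψ Φ : Spinors K) (A B : Vectors K) :
    spinorForm Ψ (gamma A (gamma B Φ)) = -spinorForm Φ (gamma B (gamma A Ψ)) := by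
  rw [spinorForm_gamma_comm, spinorForm_gamma_left]

theorem isOddOddEvenEven_commutatorForm : IsOddOddEvenEven (commutatorForm (K := K)) where
  odd_comm x y a b := by
    rw [commutatorForm_apply, commutatorForm_apply, map_sub, map_sub, spinorForm_gamma_gamma x.2,
      spinorForm_gamma_gamma x.2]
    ring
  even_neg_comm x y a b := by
    rw [commutatorForm_apply, commutatorForm_apply, ← map_neg, neg_sub]
  apply_even x hx := by
    ext <;> simp [commutatorForm_apply, mem_superPart_zero.1 hx]
  apply_odd x y a ha := by
    ext <;> simp [commutatorForm_apply, mem_superPart_one.1 ha]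

theorem bracket_eq_zero_of_mem_even {x : Supertranslation K} (hx : x ∈ part 0) :
    bracket x = 0 := by
  refine LinearMap.ext fun y => (superBracket_apply x y).trans ?_
  rw [mem_superPart_zero.1 hx, map_zero]
  rfl

theorem commutatorForm_bracket_self (x a : Supertranslation K) :
    commutatorForm x x a (bracket x x) = 0 := by
  change spinorForm x.2 (gamma a.1 (gamma (spinorDot x.2 x.2) x.2)
    - gamma (spinorDot x.2 x.2) (gamma a.1 x.2)) = 0
  have h := spinorForm_gamma_spinorDot_self x.2 a.1
  rw [map_sub, spinorForm_gamma_gamma, ← neg_eq_iff_eq_neg.2 (spinorForm_gamma_left _ _ _), h]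
  simp

/-- The `(2, 2)`-form `β` with `β(Ψ, Φ, 𝒜, ℬ) = ⟨Ψ, (𝒜ℬ - ℬ𝒜) Φ⟩`. -/
noncomputable def fourCocycle (K : Type) [NormedDivisionAlgebra K] :
    Cochain (Supertranslation K) 4 :=
  isOddOddEvenEven_commutatorForm.shuffleCochain

theorem isForm_fourCocycle : IsForm 2 2 (fourCocycle K) :=
  isOddOddEvenEven_commutatorForm.isForm_shuffleCochain

theorem fourCocycle_apply (Ψ Φ : Spinors K) (A B : Vectors K) :
    (fourCocycle K).1 ![(0, Ψ), (0, Φ), (A, 0), (B, 0)]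
      = spinorForm Ψ (cliffordAction (cliffordCommutator A B) Φ) :=
  (isOddOddEvenEven_commutatorForm.shuffleCochain_apply_even_even _ _
    (mem_superPart_zero.2 rfl) (mem_superPart_zero.2 rfl)).trans
    (spinorForm_cliffordCommutator Ψ Φ A B).symm

theorem isClosedCochain_fourCocycle : IsClosedCochain (fourCocycle K) :=
  isOddOddEvenEven_commutatorForm.isClosedCochain_shuffleCochain
    (fun _ => bracket_eq_zero_of_mem_even) fun x _ a _ => commutatorForm_bracket_self x a

theorem isForm_two_two_ext {β γ : Cochain (Supertranslation K) 4} (hβ : IsForm 2 2 β)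
    (hγ : IsForm 2 2 γ) (h : ∀ (Ψ Φ : Spinors K) (A B : Vectors K),
      β.1 ![(0, Ψ), (0, Φ), (A, 0), (B, 0)] = γ.1 ![(0, Ψ), (0, Φ), (A, 0), (B, 0)]) : β = γ := by
  refine sub_eq_zero.1 ((hβ.sub hγ).eq_zero_of_vanishesAt (s := ![1, 1, 0, 0]) (by decide)
    fun X hX => ?_)
  have hX' : X = ![(0, (X 0).2), (0, (X 1).2), ((X 2).1, 0), ((X 3).1, 0)] := by
    ext1 k
    fin_cases k
    · exact Prod.ext (mem_superPart_one.1 (hX 0)) rfl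
    · exact Prod.ext (mem_superPart_one.1 (hX 1)) rfl
    · exact Prod.ext rfl (mem_superPart_zero.1 (hX 2))
    · exact Prod.ext rfl (mem_superPart_zero.1 (hX 3))
  rw [hX']
  exact sub_eq_zero.2 (h _ _ _ _)

theorem spinorDot_single_inl_zero_inr_one :
    spinorDot (Pi.single (.inl 0) 1 : Spinors K) (Pi.single (.inr 1) 1) = 0 := by
  refine metric_separatingLeft _ fun M => ?_
  obtain ⟨a, t, x, y, rfl⟩ := exists_vec M
  rw [metric_spinorDot]
  simp [spinorForm, gammaZero, gamma_apply, vec, blockMatrix, traceReversal, dotProduct, mulVec,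
    trace_fin_two, one_apply]

theorem commutatorForm_single_vec : commutatorForm ((0, Pi.single (.inl 0) 1) : Supertranslation K)
    (0, Pi.single (.inr 1) 1) (vec 0 0 0 1, 0) (vec 0 0 1 0, 0) = 2 := by
  simp [commutatorForm_apply, spinorForm, gammaZero, gamma_apply, vec, blockMatrix, traceReversal,
    fromBlocks_mulVec, dotProduct, mulVec, trace_fin_two, one_apply, re_one, one_add_one_eq_two]

theorem not_isExactCochain_fourCocycle : ¬IsExactCochain (fourCocycle K) := fun h => by
  have value := (fourCocycle_apply _ _ _ _).trans
    ((spinorForm_cliffordCommutator _ _ _ _).trans (commutatorForm_single_vec (K := K)))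
  rw [h.apply_eq_zero (p := ![1, 1, 0, 0])] at value
  · exact two_ne_zero value.symm
  · intro k
    fin_cases k
    · exact mem_superPart_one.2 rfl
    · exact mem_superPart_one.2 rfl
    · exact mem_superPart_zero.2 rfl
    · exact mem_superPart_zero.2 rfl
  · intro i j hij
    refine (superBracket_apply _ _).trans ?_
    fin_cases i <;> fin_cases j <;> simp [spinorDot_single_inl_zero_inr_one] at hij ⊢

end Supertranslation

end SuperMinkowski

theorem mainTheorem3_general (K : Type) [NormedDivisionAlgebra K] :
    Module.finrank ℝ (Vectors K) = Module.finrank ℝ K + 3 ∧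
    ∃ β : Cochain (Supertranslation K) 4,
      (IsForm 2 2 β ∧ ∀ (Ψ Φ : Spinors K) (A B : Vectors K),
        β.1 ![(0, Ψ), (0, Φ), (A, 0), (B, 0)] =
          spinorForm Ψ (cliffordAction (cliffordCommutator A B) Φ)) ∧
      (∀ γ : Cochain (Supertranslation K) 4,
        (IsForm 2 2 γ ∧ ∀ (Ψ Φ : Spinors K) (A B : Vectors K),
          γ.1 ![(0, Ψ), (0, Φ), (A, 0), (B, 0)] =
            spinorForm Ψ (cliffordAction (cliffordCommutator A B) Φ)) → γ = β) ∧
      IsEvenCochain β ∧ IsClosedCochain β ∧ ¬ IsExactCochain β := by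
  refine ⟨finrank_vectors K, fourCocycle K, ⟨isForm_fourCocycle, fourCocycle_apply⟩, ?_,
    isForm_fourCocycle.isEvenCochain even_two, isClosedCochain_fourCocycle,
    not_isExactCochain_fourCocycle⟩
  rintro γ ⟨form, value⟩
  exact isForm_two_two_ext form isForm_fourCocycle fun Ψ Φ A B =>
    (value Ψ Φ A B).trans (fourCocycle_apply Ψ Φ A B).symm

theorem mainTheorem3 (D : ℕ) (K : Type) [NormedDivisionAlgebra K] (hK : IsSpacetimeAlgebra D K) :
    Module.finrank ℝ (Vectors K) = D ∧
    ∃ β : Cochain (Supertranslation K) 4,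
      (IsForm 2 2 β ∧ ∀ (Ψ Φ : Spinors K) (A B : Vectors K),
        β.1 ![(0, Ψ), (0, Φ), (A, 0), (B, 0)] =
          spinorForm Ψ (cliffordAction (cliffordCommutator A B) Φ)) ∧
      (∀ γ : Cochain (Supertranslation K) 4,
        (IsForm 2 2 γ ∧ ∀ (Ψ Φ : Spinors K) (A B : Vectors K),
          γ.1 ![(0, Ψ), (0, Φ), (A, 0), (B, 0)] =
            spinorForm Ψ (cliffordAction (cliffordCommutator A B) Φ)) → γ = β) ∧
      IsEvenCochain β ∧ IsClosedCochain β ∧ ¬ IsExactCochain β := by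
  exact hK.finrank_add_three ▸ mainTheorem3_general K
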